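/- \textbf{Setting.} Let $n\ge 0$ and $[n]=\{0,\dots,n\}$. A weighted simplicial complex (wsc) on $[n]$ is a function $\Omega:\mathcal P([n])\to\mathbb N$ such that $S_1\subseteq S_2$ implies $\Omega(S_1)\mid\Omega(S_2)$, with $\Omega(\{i\})\neq 0$ for all $i$. A facet is an inclusion-maximal set $F$ with $\Omega(F)\ne 0$; $\widetilde{\mathcal F}$ is the multiset containing each facet $F$ exactly $\Omega(F)$ times, and $\widetilde{\mathcal F}_i$ is the sub-multiset of those containing $i$. $\Omega$ is connected if any two vertices are linked by a finite chain of vertices in which consecutive ones lie in a common facet. An action of a group $G$ on $\Omega$ is an action on $[n]$ leaving $\Omega$ invariant, together with an action on $\widetilde{\mathcal F}$ compatible with the induced action on facets; it is free if the action on $\widetilde{\mathcal F}$ is free (then $G$ is finite). Let $\mathcal K_{n,d}=\bigotimes_{i=0}^n\mathbb C^d$. An $(\Omega,G)$-decomposition of $M\in\mathcal K_{n,d}$ consists of a finite set $\mathcal I$ and vectors $v^{[i]}_\beta\in\mathbb C^d$ ($i\in[n]$, $\beta\in\mathcal I^{\widetilde{\mathcal F}_i}$) with $$M=\sum_{\alpha\in\mathcal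 I^{\widetilde{\mathcal F}}}v^{[0]}_{\alpha|_0}\otimes\cdots\otimes v^{[n]}_{\alpha|_n},\qquad v^{[i]}_\beta=v^{[gi]}_{{}^g\beta}\quad (g\in G),$$ where $\alpha|_i$ is the restriction of $\alpha$ to $\widetilde{\mathcal F}_i$ and ${}^g\beta(F)=\beta(g^{-1}F)$. The least $|\mathcal I|$ (or $\infty$ if there is none) is $\mathrm{rank}(M)$; requiring in addition that all $v^{[i]}_\beta$ have nonnegative entries gives $\mathrm{nn\text{-}rank}(M)$. The number $\mathrm{psd\text{-}rank}(M)$ is the least $|\mathcal I|$ for which there are psd matrices $E^{[i]}_j$ ($i\in[n]$, $1\le j\le d$), indexed by $\mathcal I^{\widetilde{\mathcal F}_i}$, with $(E^{[i]}_j)_{\beta,\beta'}=(E^{[gi]}_j)_{{}^g\beta,{}^g\beta'}$ and $m_{j_0\dots j_n}=\sum_{\alpha,\alpha'\in\mathcal I^{\widetilde{\mathcal F}}}\prod_{i=0}^n (E^{[i]}_{j_i})_{\alpha|_i,\alpha'|_i}$. Finally $\mathrm{sqrt\text{-}rank}(M)$ is the minimum of $\mathrm{rank}(N)$ over real tensors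 $N$ whose entrywise square is $M$. For each of these ranks $R$ put $R^{\varepsilon,\ell_p}(M)=\min\{R(N):N\in\mathcal K_{n,d},\ \|M-N\|_{\ell_p}\le\varepsilon\}$. For a matrix $X\in\mathcal M_d^{\otimes(n+1)}$ let $\mu_p(X)=\inf\{\lambda>0:\lambda^{-1}X\in B_p\}$, where $B_p$ is the convex hull of all $\pm\rho_0\otimes\cdots\otimes\rho_n$ with psd $\rho_i\in\mathcal M_d$ and Schatten $p$-norm $\|\rho_0\otimes\cdots\otimes\rho_n\|_p\le1$, and let $\mu_{\sqrt{},p}(X)$ be the minimum of $\mu_p(Y)$ over Hermitian $Y$ with $Y^2=X$. For functions $f,g$ on a set $\mathcal X$ with values in $\mathbb N\cup\{\infty\}$, write $f\ll g$ on $\mathcal X$ if there is a sequence in $\mathcal X$ along which $f$ is bounded (by a natural number) and $g$ is not. \textbf{Statement.} Let $\Omega$ be a connected wsc on $[n]$ with a free action of $G$, let $\varepsilon>0$, $K\in\mathbb N$ and $1<p<\infty$. Let $\mathcal Y_K$ be the set of all nonnegative $G$-invariant tensors $M\in\mathcal K_{n,d}$, $d\in\mathbb N$ arbitrary, with $\|M\|_{\ell_1}\le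 K$. Then on $\mathcal Y_K$: (i) $\mathrm{rank}^{\varepsilon,\ell_p}\not\ll\mathrm{psd\text{-}rank}^{\varepsilon,\ell_p}$, (ii) $\mathrm{psd\text{-}rank}^{\varepsilon,\ell_p}\not\ll\mathrm{nn\text{-}rank}^{\varepsilon,\ell_p}$, and also $\mathrm{rank}^{\varepsilon,\ell_p}\not\ll\mathrm{nn\text{-}rank}^{\varepsilon,\ell_p}$. Moreover $\mathrm{nn\text{-}rank}^{\varepsilon,\ell_2}(M)\le\lceil D_2\,(2K/\varepsilon)^2\rceil\cdot|G|$ for all $M\in\mathcal Y_K$, where $D_2=2e^4$. Let $\mathcal Y_{\sqrt{},K}$ be the set of all nonnegative $G$-invariant tensors $M\in\mathcal K_{n,d}$, $d\in\mathbb N$ arbitrary, with $\mu_{\sqrt{},p}(\sigma)\le K$, where $\sigma$ is the diagonal matrix whose diagonal entries are the entries of $M$. Then on $\mathcal Y_{\sqrt{},K}$: (iii) $\mathrm{psd\text{-}rank}^{\varepsilon,\ell_p}\not\ll\mathrm{sqrt\text{-}rank}^{\varepsilon,\ell_p}$, (iv) $\mathrm{rank}^{\varepsilon,\ell_p}\not\ll\mathrm{sqrt\text{-}rank}^{\varepsilon,\ell_p}$.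 -/

import Mathlib

open scoped ComplexOrder ENNReal

noncomputable section

namespace ApproxTensor

/-! ### Weighted simplicial complexes and group actions on them -/

/-- A weighted simplicial complex on the vertex set `{0, …, n}`, all of whose singletons are
simplices. -/
structure WSC (n : ℕ) where
  /-- the weight function -/
  weight : Finset (Fin (n + 1)) → ℕ
  weight_dvd : ∀ S T : Finset (Fin (n + 1)), S ⊆ T → weight S ∣ weight T
  weight_singleton : ∀ i : Fin (n + 1), weight {i} ≠ 0

namespace WSC

variable {n : ℕ}

/-- A facet is an inclusion-maximal simplex, a simplex being a set of nonzero weight. -/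
def IsFacet (Ω : WSC n) (F : Finset (Fin (n + 1))) : Prop :=
  Maximal (fun S => Ω.weight S ≠ 0) F

/-- The multiset of facets: each facet `F` occurs `Ω.weight F` times. -/
def MultiFacet (Ω : WSC n) : Type :=
  Σ F : {F : Finset (Fin (n + 1)) // Ω.IsFacet F}, Fin (Ω.weight F.1)

/-- The collapse map, sending a copy of a facet to the facet itself. -/
def collapse (Ω : WSC n) (F : Ω.MultiFacet) : Finset (Fin (n + 1)) := F.1.1

/-- The multiset of facets that contain the vertex `i`. -/
def FacetsAt (Ω : WSC n) (i : Fin (n + 1)) : Type :=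
  {F : Ω.MultiFacet // i ∈ Ω.collapse F}

instance (Ω : WSC n) : Finite Ω.MultiFacet := by
  unfold MultiFacet; infer_instance

instance (Ω : WSC n) (i : Fin (n + 1)) : Finite (Ω.FacetsAt i) := by
  unfold FacetsAt; infer_instance

instance (Ω : WSC n) : Fintype Ω.MultiFacet := Fintype.ofFinite _

instance (Ω : WSC n) : DecidableEq Ω.MultiFacet := Classical.decEq _

instance (Ω : WSC n) (i : Fin (n + 1)) : Fintype (Ω.FacetsAt i) := Fintype.ofFinite _

instance (Ω : WSC n) (i : Fin (n + 1)) : DecidableEq (Ω.FacetsAt i) := Classical.decEq _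

/-- Two vertices are neighbors if they lie in a common facet. -/
def Neighbor (Ω : WSC n) (i j : Fin (n + 1)) : Prop :=
  ∃ F, Ω.IsFacet F ∧ i ∈ F ∧ j ∈ F

/-- Any two vertices are joined by a finite chain of neighbors. -/
def Connected (Ω : WSC n) : Prop :=
  ∀ i j, Relation.ReflTransGen Ω.Neighbor i j

/-- An action of the group `G` on `Ω`: an action on the vertices that leaves the weights invariant,
together with an action on the multiset of facets that refines the induced action on facets. -/
structure GroupAction (Ω : WSC n) (G : Type*) [Group G] where
  /-- the action on the vertices -/
  onVertices : G →* Equiv.Perm (Fin (n + 1))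
  /-- the action on the multiset of facets -/
  onFacets : G →* Equiv.Perm Ω.MultiFacet
  weight_map : ∀ (g : G) (S : Finset (Fin (n + 1))),
    Ω.weight (S.map (onVertices g).toEmbedding) = Ω.weight S
  collapse_map : ∀ (g : G) (F : Ω.MultiFacet),
    Ω.collapse (onFacets g F) = (Ω.collapse F).map (onVertices g).toEmbedding

namespace GroupAction

variable {Ω : WSC n} {G : Type*} [Group G]

/-- The action on the multiset of facets has trivial stabilizers. -/
def IsFree (A : Ω.GroupAction G) : Prop :=
  ∀ (g : G) (F : Ω.MultiFacet), A.onFacets g F = F → g = 1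

theorem mem_collapse_inv (A : Ω.GroupAction G) (g : G) (i : Fin (n + 1)) (F : Ω.MultiFacet)
    (h : A.onVertices g i ∈ Ω.collapse F) : i ∈ Ω.collapse (A.onFacets g⁻¹ F) := by
  rw [A.collapse_map, Finset.mem_map]
  exact ⟨A.onVertices g i, h, by simp⟩

/-- For `β` indexed by the facets at `i`, the family `ᵍβ` indexed by the facets at `g i`, given by
`ᵍβ(F) = β(g⁻¹ F)`. -/
def translate (A : Ω.GroupAction G) (g : G) {i : Fin (n + 1)} {I : Type*}
    (β : Ω.FacetsAt i → I) : Ω.FacetsAt (A.onVertices g i) → I :=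
  fun F => β ⟨A.onFacets g⁻¹ F.1, A.mem_collapse_inv g i F.1 F.2⟩

end GroupAction

/-- The restriction of `α` to the facets at the vertex `i`. -/
def restrict (Ω : WSC n) {I : Type*} (α : Ω.MultiFacet → I) (i : Fin (n + 1)) :
    Ω.FacetsAt i → I :=
  fun F => α F.1

end WSC

/-! ### Tensors -/

/-- Tensors in `ℂ^d ⊗ ⋯ ⊗ ℂ^d` (`n + 1` factors), given by their coordinates in the standard
basis; the coordinates of `v₀ ⊗ ⋯ ⊗ vₙ` are the products `v₀(j₀) ⋯ vₙ(jₙ)`. -/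
abbrev Tensor (n d : ℕ) : Type := (Fin (n + 1) → Fin d) → ℂ

/-- All coordinates are nonnegative real numbers. -/
def Tensor.IsNonneg {n d : ℕ} (M : Tensor n d) : Prop := ∀ j, 0 ≤ M j

/-- The `ℓ_p`-norm of a tensor. -/
def Tensor.lpNorm {n d : ℕ} (p : ℝ) (M : Tensor n d) : ℝ := (∑ j, ‖M j‖ ^ p) ^ (1 / p)

namespace WSC.GroupAction

variable {n : ℕ} {Ω : WSC n} {G : Type*} [Group G]

/-- Invariance under the induced action that permutes the tensor factors. -/
def IsInvariant (A : Ω.GroupAction G) {d : ℕ} (M : Tensor n d) : Prop :=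
  ∀ (g : G) (j : Fin (n + 1) → Fin d), M (fun i => j (A.onVertices g i)) = M j

/-! ### Exact decompositions and ranks -/

/-- The families `v i` of vectors in `ℂ^d` form an `(Ω,G)`-decomposition of `M` with index
set `I`. -/
def IsDecomposition (A : Ω.GroupAction G) {d : ℕ} {I : Type*} [Fintype I]
    (v : ∀ i : Fin (n + 1), (Ω.FacetsAt i → I) → Fin d → ℂ) (M : Tensor n d) : Prop :=
  (∀ j : Fin (n + 1) → Fin d,
    M j = ∑ α : Ω.MultiFacet → I, ∏ i : Fin (n + 1), v i (Ω.restrict α i) (j i)) ∧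
  ∀ (i : Fin (n + 1)) (g : G) (β : Ω.FacetsAt i → I),
    v i β = v (A.onVertices g i) (A.translate g β)

/-- The matrices `E i j` form a positive semidefinite `(Ω,G)`-decomposition of `M` with index
set `I`. -/
def IsPsdDecomposition (A : Ω.GroupAction G) {d : ℕ} {I : Type*} [Fintype I]
    (E : ∀ i : Fin (n + 1), Fin d → Matrix (Ω.FacetsAt i → I) (Ω.FacetsAt i → I) ℂ)
    (M : Tensor n d) : Prop :=
  (∀ i j, (E i j).PosSemidef) ∧
  (∀ (i : Fin (n + 1)) (g : G) (j : Fin d) (β β' : Ω.FacetsAt i → I),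
    E i j β β' = E (A.onVertices g i) j (A.translate g β) (A.translate g β')) ∧
  ∀ j : Fin (n + 1) → Fin d,
    M j = ∑ α : Ω.MultiFacet → I, ∑ α' : Ω.MultiFacet → I,
      ∏ i : Fin (n + 1), E i (j i) (Ω.restrict α i) (Ω.restrict α' i)

/-- The `(Ω,G)`-rank: the least cardinality of the index set of an `(Ω,G)`-decomposition, and `⊤`
if there is none. -/
def rank (A : Ω.GroupAction G) {d : ℕ} (M : Tensor n d) : ℕ∞ :=
  ⨅ (r : ℕ) (_ : ∃ v : ∀ i : Fin (n + 1), (Ω.FacetsAt i → Fin r) → Fin d → ℂ,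
    A.IsDecomposition v M), (r : ℕ∞)

/-- The nonnegative `(Ω,G)`-rank. -/
def nnRank (A : Ω.GroupAction G) {d : ℕ} (M : Tensor n d) : ℕ∞ :=
  ⨅ (r : ℕ) (_ : ∃ v : ∀ i : Fin (n + 1), (Ω.FacetsAt i → Fin r) → Fin d → ℂ,
    A.IsDecomposition v M ∧ ∀ i β j, 0 ≤ v i β j), (r : ℕ∞)

/-- The positive semidefinite `(Ω,G)`-rank. -/
def psdRank (A : Ω.GroupAction G) {d : ℕ} (M : Tensor n d) : ℕ∞ :=
  ⨅ (r : ℕ) (_ : ∃ E : ∀ i : Fin (n + 1), Fin d →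
      Matrix (Ω.FacetsAt i → Fin r) (Ω.FacetsAt i → Fin r) ℂ,
    A.IsPsdDecomposition E M), (r : ℕ∞)

/-- The `(Ω,G)`-square root rank: the least `(Ω,G)`-rank of a tensor with real entries whose
entrywise square is `M`. -/
def sqrtRank (A : Ω.GroupAction G) {d : ℕ} (M : Tensor n d) : ℕ∞ :=
  ⨅ (N : Tensor n d) (_ : (∀ j, (N j).im = 0) ∧ ∀ j, M j = N j ^ 2), A.rank N

/-! ### Approximate ranks: minimize the exact rank over the closed `ε`-ball in `ℓ_p`-norm -/

/-- The approximate `(Ω,G)`-rank. -/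
def approxRank (A : Ω.GroupAction G) (ε p : ℝ) {d : ℕ} (M : Tensor n d) : ℕ∞ :=
  ⨅ (N : Tensor n d) (_ : Tensor.lpNorm p (M - N) ≤ ε), A.rank N

/-- The approximate nonnegative `(Ω,G)`-rank. -/
def approxNnRank (A : Ω.GroupAction G) (ε p : ℝ) {d : ℕ} (M : Tensor n d) : ℕ∞ :=
  ⨅ (N : Tensor n d) (_ : Tensor.lpNorm p (M - N) ≤ ε), A.nnRank N

/-- The approximate positive semidefinite `(Ω,G)`-rank. -/
def approxPsdRank (A : Ω.GroupAction G) (ε p : ℝ) {d : ℕ} (M : Tensor n d) : ℕ∞ :=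
  ⨅ (N : Tensor n d) (_ : Tensor.lpNorm p (M - N) ≤ ε), A.psdRank N

/-- The approximate `(Ω,G)`-square root rank. -/
def approxSqrtRank (A : Ω.GroupAction G) (ε p : ℝ) {d : ℕ} (M : Tensor n d) : ℕ∞ :=
  ⨅ (N : Tensor n d) (_ : Tensor.lpNorm p (M - N) ≤ ε), A.sqrtRank N

end WSC.GroupAction

/-! ### The gauge functions -/

/-- Matrices in `M_d ⊗ ⋯ ⊗ M_d` (`n + 1` factors). -/
abbrev TensorMatrix (n d : ℕ) : Type :=
  Matrix (Fin (n + 1) → Fin d) (Fin (n + 1) → Fin d) ℂ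

/-- The elementary tensor `ρ₀ ⊗ ⋯ ⊗ ρₙ` of matrices. -/
def tensorProd {n d : ℕ} (ρ : Fin (n + 1) → Matrix (Fin d) (Fin d) ℂ) : TensorMatrix n d :=
  Matrix.of fun a b => ∏ i, ρ i (a i) (b i)

/-- The Schatten `p`-norm: the `ℓ_p`-norm of the singular values, which are the square roots of the
eigenvalues of `Aᴴ * A`. -/
def schattenNorm {m : Type*} [Fintype m] [DecidableEq m] (p : ℝ) (A : Matrix m m ℂ) : ℝ :=
  (∑ i, Real.sqrt ((Matrix.isHermitian_conjTranspose_mul_self A).eigenvalues i) ^ p) ^ (1 / p)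

/-- The set of all `± ρ₀ ⊗ ⋯ ⊗ ρₙ` with positive semidefinite `ρᵢ` and Schatten `p`-norm at
most `1`. -/
def productSet (n d : ℕ) (p : ℝ) : Set (TensorMatrix n d) :=
  {X | ∃ ρ : Fin (n + 1) → Matrix (Fin d) (Fin d) ℂ, (∀ i, (ρ i).PosSemidef) ∧
    schattenNorm p (tensorProd ρ) ≤ 1 ∧ (X = tensorProd ρ ∨ X = -tensorProd ρ)}

/-- The gauge `μ_p(X) = inf {l > 0 | X / l ∈ conv (productSet n d p)}`, with `inf ∅ = ∞`. -/
def mu {n d : ℕ} (p : ℝ) (X : TensorMatrix n d) : ℝ≥0∞ :=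
  ⨅ (l : ℝ) (_ : 0 < l ∧ l⁻¹ • X ∈ convexHull ℝ (productSet n d p)), ENNReal.ofReal l

/-- The minimum of `μ_p` over all Hermitian square roots of `X`. -/
def muSqrt {n d : ℕ} (p : ℝ) (X : TensorMatrix n d) : ℝ≥0∞ :=
  ⨅ (Y : TensorMatrix n d) (_ : Y.IsHermitian ∧ Y * Y = X), mu p Y

/-! ### Separations -/

/-- `f ≪ g` on `X`: along some sequence in `X`, `f` is bounded and `g` is not. -/
def Separated {α : Type*} (X : Set α) (f g : α → ℕ∞) : Prop :=
  ∃ x : ℕ → α, (∀ k, x k ∈ X) ∧ (∃ C : ℕ, ∀ k, f (x k) ≤ C) ∧ ¬ ∃ C : ℕ, ∀ k, g (x k) ≤ C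

/-- The nonnegative `G`-invariant tensors of arbitrary local dimension with `ℓ_1`-norm at
most `K`. -/
def boundedTensors {n : ℕ} {Ω : WSC n} {G : Type*} [Group G] (A : Ω.GroupAction G) (K : ℕ) :
    Set (Σ d : ℕ, Tensor n d) :=
  {M | M.2.IsNonneg ∧ A.IsInvariant M.2 ∧ Tensor.lpNorm 1 M.2 ≤ K}

/-- The nonnegative `G`-invariant tensors of arbitrary local dimension whose associated diagonal
matrix `σ` satisfies `muSqrt p σ ≤ K`. -/
def sqrtBoundedTensors {n : ℕ} {Ω : WSC n} {G : Type*} [Group G] (A : Ω.GroupAction G) (p : ℝ)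
    (K : ℕ) : Set (Σ d : ℕ, Tensor n d) :=
  {M | M.2.IsNonneg ∧ A.IsInvariant M.2 ∧ muSqrt p (Matrix.diagonal M.2) ≤ K}

/-- The constant `D_p = 2 (p - 1) e⁴`. -/
def constD (p : ℝ) : ℝ := 2 * (p - 1) * Real.exp 4

end ApproxTensor

end

/-!
Every approximate rank on the right-hand side of a separation is bounded on the whole set in
question, so that no sequence can separate it from anything.

The bounds come from truncation. If the coordinates `m` of a nonnegative tensor satisfy
`∑ m ^ s ≤ C` with `0 < s < p`, deleting the coordinates below `δ` changes the tensor by at most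
`(δ ^ (p - s) * C) ^ (1 / p)` in `ℓ_p`-norm and leaves at most `C / δ ^ s` coordinates, neither of
which depends on the local dimension (`Tensor.IsNonneg.lpNorm_sub_truncate_le`,
`Tensor.IsNonneg.card_largeSupport_le`). Truncation is coordinatewise, hence it preserves
invariance and commutes with the coordinatewise square root.

An invariant tensor with `r` nonzero coordinates has an `(Ω,G)`-decomposition with `r * |G|`
indices, nonnegative if the tensor is (`exists_isDecomposition`): it is the average of the
`G`-translates of its expansion in the standard basis. The index of a facet `F` names a basis tensor
together with a group element relative to `z F`, where `z` is an equivariant labelling of the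
facets, which exists because the action is free. Connectedness of `Ω` forces the indices to be
globally consistent. Diagonal matrices bound the positive semidefinite rank by the nonnegative one.

For a tensor of bounded `ℓ_1`-norm one takes `s = 1`. For a bound on `muSqrt p` one takes
`s = p / 2`: in an eigenbasis of a Hermitian `Y`, the `ℓ_p`-norm of the diagonal is a convex
function that is at most `1` on the generators of `B_p` by Jensen's inequality
(`sum_norm_diag_rpow_le`), so that `μ_p (Y)` dominates the `ℓ_p`-norm of the eigenvalues of `Y`,
whose squares are the coordinates of the tensor if `Y * Y` is the associated diagonal matrix.
-/

namespace ApproxTensor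

open Finset

/-! ### Facets and free actions -/

namespace WSC

variable {n : ℕ}

theorem exists_facetsAt (Ω : WSC n) (i : Fin (n + 1)) : Nonempty (Ω.FacetsAt i) := by
  obtain ⟨F, hF, hmax⟩ := Set.Finite.exists_le_maximal
    (s := {S : Finset (Fin (n + 1)) | Ω.weight S ≠ 0}) (Set.toFinite _) (Ω.weight_singleton i)
  exact ⟨⟨⟨⟨F, hmax⟩, ⟨0, Nat.pos_of_ne_zero hmax.prop⟩⟩, hF (mem_singleton_self i)⟩⟩

instance (Ω : WSC n) : Nonempty Ω.MultiFacet :=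
  (Ω.exists_facetsAt 0).map Subtype.val

theorem MultiFacet.exists_mem_collapse {Ω : WSC n} (F : Ω.MultiFacet) :
    ∃ i, i ∈ Ω.collapse F := by
  by_contra! h
  have h0 : Ω.collapse F = ∅ := eq_empty_of_forall_notMem h
  have := F.1.2.le_of_ge (Ω.weight_singleton 0) (by
    change Ω.collapse F ≤ _
    rw [h0]; exact bot_le)
  exact h 0 (this (mem_singleton_self 0))

/-- A family indexed by the vertices of a connected complex is constant if it agrees on any two
vertices of a common facet. -/
theorem Connected.eq_of_neighbor {Ω : WSC n} (hΩ : Ω.Connected) {X : Type*}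
    {f : Fin (n + 1) → X} (hf : ∀ i j (F : Ω.MultiFacet), i ∈ Ω.collapse F → j ∈ Ω.collapse F →
      f i = f j) (i j : Fin (n + 1)) : f i = f j := by
  induction hΩ i j with
  | refl => rfl
  | tail _ h ih =>
    obtain ⟨F, hF, hi, hj⟩ := h
    exact ih.trans (hf _ _ ⟨⟨F, hF⟩, ⟨0, Nat.pos_of_ne_zero hF.prop⟩⟩ hi hj)

namespace GroupAction

variable {Ω : WSC n} {G : Type*} [Group G] (A : Ω.GroupAction G)

theorem IsFree.finite {A : Ω.GroupAction G} (hA : A.IsFree) : Finite G := by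
  obtain ⟨F⟩ : Nonempty Ω.MultiFacet := inferInstance
  refine Finite.of_injective (fun g => A.onFacets g F) fun g h hgh => ?_
  have : A.onFacets (h⁻¹ * g) F = F := by
    have hgh : A.onFacets g F = A.onFacets h F := hgh
    rw [map_mul, Equiv.Perm.mul_apply, hgh, ← Equiv.Perm.mul_apply, ← map_mul]
    simp
  exact (inv_mul_eq_one.1 (hA _ _ this)).symm

/-- A free action on the facets admits an equivariant labelling of the facets by group elements:
choose a representative of each orbit and label it by `1`. -/
theorem IsFree.exists_equivariant {A : Ω.GroupAction G} (hA : A.IsFree) :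
    ∃ z : Ω.MultiFacet → G, ∀ g F, z (A.onFacets g F) = g * z F := by
  let _ : MulAction G Ω.MultiFacet := MulAction.compHom _ A.onFacets
  have hsmul : ∀ (g : G) (F : Ω.MultiFacet), g • F = A.onFacets g F := fun _ _ => rfl
  let rep : Ω.MultiFacet → Ω.MultiFacet := fun F =>
    (Quotient.mk (MulAction.orbitRel G Ω.MultiFacet) F).out
  have hrep : ∀ F, ∃ g : G, g • rep F = F := fun F => by
    have := Quotient.mk_out (s := MulAction.orbitRel G Ω.MultiFacet) F
    exact MulAction.orbitRel_apply.1 ((MulAction.orbitRel G Ω.MultiFacet).symm this)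
  choose z hz using hrep
  refine ⟨z, fun g F => ?_⟩
  have h1 : rep (A.onFacets g F) = rep F := by
    refine congrArg Quotient.out (Quotient.sound ?_)
    exact MulAction.orbitRel_apply.2 ⟨g, rfl⟩
  have h2 := hz (A.onFacets g F)
  rw [h1, ← hsmul] at h2
  have h3 : ((g * z F)⁻¹ * z (g • F)) • rep F = rep F := by
    rw [mul_smul, h2, inv_smul_eq_iff, mul_smul, hz]
  exact (inv_mul_eq_one.1 (hA _ _ h3)).symm

theorem translate_onFacets (g : G) {i : Fin (n + 1)} {I : Type*} (β : Ω.FacetsAt i → I)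
    (F : Ω.FacetsAt i) (hF : A.onVertices g i ∈ Ω.collapse (A.onFacets g F.1)) :
    A.translate g β ⟨A.onFacets g F.1, hF⟩ = β F :=
  congrArg β (Subtype.ext (by simp))

theorem translate_injective (g : G) {i : Fin (n + 1)} {I : Type*} :
    Function.Injective (A.translate g : (Ω.FacetsAt i → I) → _) := by
  intro β β' h
  funext F
  have hF : A.onVertices g i ∈ Ω.collapse (A.onFacets g F.1) := by
    rw [A.collapse_map]
    exact mem_map_of_mem _ F.2
  have := congrFun h ⟨A.onFacets g F.1, hF⟩
  rwa [translate_onFacets, translate_onFacets] at this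

/-! ### Decompositions from orbit sums of elementary tensors -/

section OrbitSum

variable {L I : Type*} {d : ℕ}

theorem eq_of_label_eq {a b : L × G} {t : G} (h : (a.1, t⁻¹ * a.2) = (b.1, t⁻¹ * b.2)) :
    a = b := by
  simp only [Prod.mk.injEq, mul_right_inj] at h
  exact Prod.ext h.1 h.2

variable [Fintype L] [Fintype G]

open Classical in
/-- Local vectors realizing the sum of the `G`-orbits of the elementary tensors `w l`. The facet
index `(l, (z F)⁻¹ * h)` records the summand `l` together with its translate by `h`; the vector at
the vertex `i` vanishes unless the indices of all facets at `i` record the same pair `(l, h)`. -/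
noncomputable def orbitVectors (z : Ω.MultiFacet → G) (e : I ≃ L × G)
    (w : L → Fin (n + 1) → Fin d → ℂ) (i : Fin (n + 1)) (β : Ω.FacetsAt i → I) : Fin d → ℂ :=
  ∑ a : L × G, if ∀ F, e (β F) = (a.1, (z F.1)⁻¹ * a.2) then w a.1 (A.onVertices a.2⁻¹ i) else 0

variable {z : Ω.MultiFacet → G} {e : I ≃ L × G} {w : L → Fin (n + 1) → Fin d → ℂ}

theorem orbitVectors_nonneg (hw : ∀ l i x, 0 ≤ w l i x) (i : Fin (n + 1))
    (β : Ω.FacetsAt i → I) (x : Fin d) : 0 ≤ A.orbitVectors z e w i β x := by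
  rw [orbitVectors, Finset.sum_apply]
  refine Finset.sum_nonneg fun a _ => ?_
  split_ifs
  · exact hw _ _ _
  · exact le_rfl

theorem orbitVectors_of_forall {i : Fin (n + 1)} {β : Ω.FacetsAt i → I} {a : L × G}
    (h : ∀ F, e (β F) = (a.1, (z F.1)⁻¹ * a.2)) :
    A.orbitVectors z e w i β = w a.1 (A.onVertices a.2⁻¹ i) := by
  classical
  rw [orbitVectors, Finset.sum_eq_single a, if_pos h]
  · intro b _ hb
    rw [if_neg]
    intro h'
    obtain ⟨F⟩ := Ω.exists_facetsAt i
    exact hb (eq_of_label_eq ((h' F).symm.trans (h F)))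
  · simp

theorem exists_of_orbitVectors_ne_zero {i : Fin (n + 1)} {β : Ω.FacetsAt i → I} {x : Fin d}
    (h : A.orbitVectors z e w i β x ≠ 0) :
    ∃ a : L × G, ∀ F, e (β F) = (a.1, (z F.1)⁻¹ * a.2) := by
  rw [orbitVectors, Finset.sum_apply] at h
  obtain ⟨a, -, ha⟩ := Finset.exists_ne_zero_of_sum_ne_zero h
  refine ⟨a, ?_⟩
  by_contra hn
  rw [if_neg hn] at ha
  exact ha rfl

theorem orbitVectors_translate (hz : ∀ g F, z (A.onFacets g F) = g * z F) (i : Fin (n + 1)) (g : G)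
    (β : Ω.FacetsAt i → I) :
    A.orbitVectors z e w i β =
      A.orbitVectors z e w (A.onVertices g i) (A.translate g β) := by
  classical
  unfold orbitVectors
  refine Fintype.sum_equiv ((Equiv.refl L).prodCongr (Equiv.mulLeft g)) _ _ fun a => ?_
  have hiff : (∀ F : Ω.FacetsAt i, e (β F) = (a.1, (z F.1)⁻¹ * a.2)) ↔
      ∀ F, e (A.translate g β F) = (a.1, (z F.1)⁻¹ * (g * a.2)) := by
    constructor
    · intro h F
      refine (h _).trans ?_
      simp only [hz, mul_inv_rev, inv_inv, mul_assoc]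
    · intro h F
      have hF : A.onVertices g i ∈ Ω.collapse (A.onFacets g F.1) := by
        rw [A.collapse_map]
        exact mem_map_of_mem _ F.2
      have := h ⟨A.onFacets g F.1, hF⟩
      rw [A.translate_onFacets, hz] at this
      simpa [mul_assoc] using this
  have hv : A.onVertices (g * a.2)⁻¹ (A.onVertices g i) = A.onVertices a.2⁻¹ i := by
    rw [← Equiv.Perm.mul_apply, ← map_mul]
    simp
  simp only [Equiv.prodCongr_apply, Prod.map, Equiv.refl_apply, Equiv.coe_mulLeft, hv]
  exact if_congr hiff rfl rfl

/-- Connectedness forces the labels `(l, h)` recorded at the vertices to agree, so that only the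
globally consistent indices `α` contribute. -/
theorem sum_prod_orbitVectors [Fintype I] (hΩ : Ω.Connected) (j : Fin (n + 1) → Fin d) :
    ∑ α : Ω.MultiFacet → I, ∏ i, A.orbitVectors z e w i (Ω.restrict α i) (j i) =
      ∑ a : L × G, ∏ i, w a.1 (A.onVertices a.2⁻¹ i) (j i) := by
  symm
  refine Finset.sum_of_injOn (fun a F => e.symm (a.1, (z F)⁻¹ * a.2)) ?_ (by simp) ?_ ?_
  · intro a _ b _ hab
    obtain ⟨F⟩ : Nonempty Ω.MultiFacet := inferInstance
    exact eq_of_label_eq (e.symm.injective (congrFun hab F))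
  · intro α _ hα
    by_contra hne
    have hne' := fun i => Finset.prod_ne_zero_iff.1 hne i (mem_univ i)
    choose a ha using fun i => A.exists_of_orbitVectors_ne_zero (hne' i)
    have hconst : ∀ i i', a i = a i' := hΩ.eq_of_neighbor fun i i' F hi hi' =>
      eq_of_label_eq (((ha i ⟨F, hi⟩).symm.trans (ha i' ⟨F, hi'⟩)))
    refine hα ⟨a 0, by simp, ?_⟩
    funext F
    obtain ⟨i, hi⟩ := F.exists_mem_collapse
    rw [Equiv.symm_apply_eq, hconst 0 i]
    exact (ha i ⟨F, hi⟩).symm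
  · intro a _
    refine Finset.prod_congr rfl fun i _ => ?_
    rw [A.orbitVectors_of_forall (a := a)]
    intro F
    simp [restrict]

end OrbitSum

/-- An invariant tensor is the average over `G` of the expansion in the standard basis, hence an
orbit sum of as many elementary tensors as it has nonzero coordinates. -/
theorem exists_isDecomposition (hΩ : Ω.Connected) (hA : A.IsFree) {d : ℕ} {N : Tensor n d}
    (hN : A.IsInvariant N) (S : Finset (Fin (n + 1) → Fin d)) (hS : ∀ j, j ∉ S → N j = 0) :
    ∃ v : ∀ i : Fin (n + 1), (Ω.FacetsAt i → Fin (#S * Nat.card G)) → Fin d → ℂ,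
      A.IsDecomposition v N ∧ (N.IsNonneg → ∀ i β x, 0 ≤ v i β x) := by
  have := hA.finite
  have := Fintype.ofFinite G
  obtain ⟨z, hz⟩ := hA.exists_equivariant
  have hcard : Fintype.card (S × G) = #S * Nat.card G := by simp
  let e : Fin (#S * Nat.card G) ≃ S × G := (Fintype.equivFinOfCardEq hcard).symm
  -- the coordinate `N l`, divided by `|G|` for the average, is put into the tensor factor `0`
  let w : S → Fin (n + 1) → Fin d → ℂ := fun l i x =>
    (if i = 0 then N l.1 / Nat.card G else 1) * if x = l.1 i then 1 else 0
  refine ⟨A.orbitVectors z e w, ⟨fun j => ?_, fun i g β => A.orbitVectors_translate hz i g β⟩,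
    fun hpos => A.orbitVectors_nonneg fun l i x => ?_⟩
  · rw [A.sum_prod_orbitVectors hΩ, Fintype.sum_prod_type_right]
    have key : ∀ h : G, ∑ l : S, ∏ i, w l (A.onVertices h⁻¹ i) (j i) = N j / Nat.card G := by
      intro h
      rw [← hN h j]
      have h1 : ∀ l : S, ∏ i, w l (A.onVertices h⁻¹ i) (j i) =
          if (fun i => j (A.onVertices h i)) = l.1 then N l.1 / Nat.card G else 0 := by
        intro l
        rw [← Equiv.prod_comp (A.onVertices h)]
        have h2 : ∀ i, A.onVertices h⁻¹ (A.onVertices h i) = i := fun i => by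
          rw [← Equiv.Perm.mul_apply, ← map_mul]; simp
        simp only [h2, w, Finset.prod_mul_distrib, Finset.prod_ite_eq', mem_univ, if_true]
        rw [Fintype.prod_ite_zero]
        simp only [Finset.prod_const_one, funext_iff]
        split_ifs <;> simp
      rw [Finset.sum_congr rfl fun l _ => h1 l]
      by_cases hj : (fun i => j (A.onVertices h i)) ∈ S
      · rw [Finset.sum_eq_single ⟨_, hj⟩]
        · simp
        · rintro ⟨l, hl⟩ _ hne
          rw [if_neg]
          rintro rfl
          exact hne rfl
        · simp
      · rw [hS _ hj, zero_div]
        refine Finset.sum_eq_zero fun l _ => if_neg ?_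
        intro hl
        exact hj (hl ▸ l.2)
    rw [Finset.sum_congr rfl fun h _ => key h, Finset.sum_const, card_univ,
      ← Nat.card_eq_fintype_card, nsmul_eq_mul, mul_div_cancel₀]
    exact_mod_cast Nat.card_pos.ne'
  · have h0 : (0 : ℂ) ≤ N l.1 / Nat.card G := div_nonneg (hpos _) (Nat.cast_nonneg _)
    simp only [w]
    split_ifs <;> simp only [mul_one, mul_zero, le_refl, zero_le_one, h0]

theorem nnRank_le (hΩ : Ω.Connected) (hA : A.IsFree) {d : ℕ} {N : Tensor n d}
    (hN : A.IsInvariant N) (hpos : N.IsNonneg) (S : Finset (Fin (n + 1) → Fin d))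
    (hS : ∀ j, j ∉ S → N j = 0) : A.nnRank N ≤ (#S * Nat.card G : ℕ) := by
  obtain ⟨v, hv, hv'⟩ := A.exists_isDecomposition hΩ hA hN S hS
  exact iInf₂_le _ ⟨v, hv, hv' hpos⟩

theorem rank_le (hΩ : Ω.Connected) (hA : A.IsFree) {d : ℕ} {N : Tensor n d}
    (hN : A.IsInvariant N) (S : Finset (Fin (n + 1) → Fin d))
    (hS : ∀ j, j ∉ S → N j = 0) : A.rank N ≤ (#S * Nat.card G : ℕ) := by
  obtain ⟨v, hv, -⟩ := A.exists_isDecomposition hΩ hA hN S hS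
  exact iInf₂_le _ ⟨v, hv⟩

/-- Nonnegative local vectors become the diagonals of positive semidefinite local matrices. -/
theorem psdRank_le_nnRank {d : ℕ} (N : Tensor n d) : A.psdRank N ≤ A.nnRank N := by
  refine le_iInf₂ fun r ⟨v, ⟨hv, hinv⟩, hpos⟩ => iInf₂_le r
    ⟨fun i x => Matrix.diagonal fun β => v i β x, fun i x => ?_, fun i g x β β' => ?_, fun j => ?_⟩
  · exact Matrix.PosSemidef.diagonal fun β => hpos i β x
  · simp only [Matrix.diagonal_apply, (A.translate_injective g).eq_iff]
    rw [← hinv]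
  · rw [hv]
    refine Finset.sum_congr rfl fun α _ => ?_
    rw [Finset.sum_eq_single α]
    · simp
    · intro α' _ hne
      obtain ⟨F, hF⟩ := Function.ne_iff.1 hne
      obtain ⟨i, hi⟩ := F.exists_mem_collapse
      refine Finset.prod_eq_zero (mem_univ i) (Matrix.diagonal_apply_ne _ fun h => hF ?_)
      exact (congrFun h ⟨F, hi⟩).symm
    · simp

theorem approxPsdRank_le_approxNnRank (ε p : ℝ) {d : ℕ} (M : Tensor n d) :
    A.approxPsdRank ε p M ≤ A.approxNnRank ε p M :=
  iInf₂_mono fun N _ => A.psdRank_le_nnRank N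

end GroupAction

end WSC

/-! ### Truncation of tensors -/

open Classical in
/-- The tensor obtained from `M` by deleting the coordinates with real part below `δ`. -/
noncomputable def Tensor.truncate {n d : ℕ} (δ : ℝ) (M : Tensor n d) : Tensor n d :=
  fun j => if δ ≤ (M j).re then M j else 0

open Classical in
/-- The positions of the coordinates with real part at least `δ`. -/
noncomputable def Tensor.largeSupport {n d : ℕ} (δ : ℝ) (M : Tensor n d) :
    Finset (Fin (n + 1) → Fin d) :=
  univ.filter fun j => δ ≤ (M j).re

namespace Tensor

variable {n d : ℕ} {M : Tensor n d} {δ : ℝ}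

theorem IsNonneg.ofReal_re (hM : M.IsNonneg) (j) : ((M j).re : ℂ) = M j :=
  (Complex.eq_re_of_ofReal_le (hM j)).symm

theorem IsNonneg.norm_eq (hM : M.IsNonneg) (j) : ‖M j‖ = (M j).re :=
  Complex.ofReal_injective ((RCLike.norm_of_nonneg' (hM j)).trans (hM.ofReal_re j).symm)

theorem IsNonneg.re_nonneg (hM : M.IsNonneg) (j) : 0 ≤ (M j).re :=
  (Complex.nonneg_iff.1 (hM j)).1

theorem IsNonneg.truncate (hM : M.IsNonneg) : (M.truncate δ).IsNonneg := by
  intro j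
  unfold Tensor.truncate
  split_ifs
  · exact hM j
  · exact le_rfl

theorem truncate_eq_zero {j} (hj : j ∉ M.largeSupport δ) : M.truncate δ j = 0 := by
  simp only [largeSupport, mem_filter, mem_univ, true_and] at hj
  exact if_neg hj

theorem IsNonneg.card_largeSupport_le (hM : M.IsNonneg) {s C : ℝ} (hs : 0 < s) (hδ : 0 < δ)
    (hC : ∑ j, (M j).re ^ s ≤ C) : (#(M.largeSupport δ) : ℝ) ≤ C / δ ^ s := by
  rw [le_div_iff₀ (by positivity), ← nsmul_eq_mul]
  refine (Finset.card_nsmul_le_sum _ (fun j => (M j).re ^ s) _ fun j hj => ?_).trans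
    ((Finset.sum_le_univ_sum_of_nonneg fun j => ?_).trans hC)
  · exact Real.rpow_le_rpow hδ.le (by simpa [largeSupport] using hj) hs.le
  · exact Real.rpow_nonneg (hM.re_nonneg j) _

/-- The deleted coordinates `m < δ` satisfy `m ^ p ≤ δ ^ (p - s) * m ^ s`. -/
theorem IsNonneg.lpNorm_sub_truncate_le (hM : M.IsNonneg) {s p C ε : ℝ} (hs : 0 < s) (hsp : s ≤ p)
    (hε : 0 ≤ ε) (hδ : 0 < δ) (hC : ∑ j, (M j).re ^ s ≤ C) (h : δ ^ (p - s) * C ≤ ε ^ p) :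
    lpNorm p (M - M.truncate δ) ≤ ε := by
  have hp : 0 < p := hs.trans_le hsp
  have hsum : ∑ j, ‖(M - M.truncate δ) j‖ ^ p ≤ ε ^ p := by
    refine le_trans ?_ h
    refine le_trans ?_ (mul_le_mul_of_nonneg_left hC (by positivity))
    rw [Finset.mul_sum]
    refine Finset.sum_le_sum fun j _ => ?_
    have hre := hM.re_nonneg j
    rw [Pi.sub_apply, Tensor.truncate]
    split_ifs with hj
    · rw [sub_self, norm_zero, Real.zero_rpow hp.ne']
      positivity
    · rw [sub_zero, hM.norm_eq]
      rcases hre.eq_or_lt with h0 | h0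
      · rw [← h0, Real.zero_rpow hp.ne']
        positivity
      · calc (M j).re ^ p = (M j).re ^ (p - s) * (M j).re ^ s := by
              rw [← Real.rpow_add h0, sub_add_cancel]
          _ ≤ _ := by
              gcongr
              exact (not_le.1 hj).le
  rw [lpNorm]
  calc _ ≤ (ε ^ p) ^ (1 / p) := by gcongr
    _ = ε := by rw [← Real.rpow_mul hε, mul_one_div_cancel hp.ne', Real.rpow_one]

end Tensor

theorem exists_truncation_level {t C η : ℝ} (ht : 0 < t) (hC : 0 ≤ C) (hη : 0 < η) :
    ∃ δ : ℝ, 0 < δ ∧ δ ^ t * C ≤ η := by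
  refine ⟨(η / (C + 1)) ^ t⁻¹, by positivity, ?_⟩
  rw [← Real.rpow_mul (by positivity), inv_mul_cancel₀ ht.ne', Real.rpow_one, div_mul_eq_mul_div,
    div_le_iff₀ (by positivity)]
  nlinarith

namespace WSC.GroupAction

variable {n : ℕ} {Ω : WSC n} {G : Type*} [Group G] (A : Ω.GroupAction G) {d : ℕ} {M : Tensor n d}

theorem IsInvariant.truncate {A : Ω.GroupAction G} (hM : A.IsInvariant M) (δ : ℝ) :
    A.IsInvariant (M.truncate δ) := by
  intro g j
  simp only [Tensor.truncate, hM g j]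

theorem approxNnRank_le (hΩ : Ω.Connected) (hA : A.IsFree) (hM : A.IsInvariant M)
    (hpos : M.IsNonneg) {ε p δ : ℝ} (h : Tensor.lpNorm p (M - M.truncate δ) ≤ ε) :
    A.approxNnRank ε p M ≤ (#(M.largeSupport δ) * Nat.card G : ℕ) :=
  (iInf₂_le (M.truncate δ) h).trans (A.nnRank_le hΩ hA (hM.truncate δ) hpos.truncate _
    fun _ => Tensor.truncate_eq_zero)

/-- The coordinatewise square root of the truncated tensor is again an invariant tensor with small
support. -/
theorem approxSqrtRank_le (hΩ : Ω.Connected) (hA : A.IsFree) (hM : A.IsInvariant M)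
    (hpos : M.IsNonneg) {ε p δ : ℝ} (h : Tensor.lpNorm p (M - M.truncate δ) ≤ ε) :
    A.approxSqrtRank ε p M ≤ (#(M.largeSupport δ) * Nat.card G : ℕ) := by
  let N : Tensor n d := fun j => (Real.sqrt (M.truncate δ j).re : ℂ)
  refine (iInf₂_le (M.truncate δ) h).trans (
    (iInf₂_le N ⟨fun j => Complex.ofReal_im _, fun j => ?_⟩).trans (A.rank_le hΩ hA ?_ _ fun j hj => ?_))
  · intro g j
    simp only [N, hM.truncate δ g j]
  · simp [N, Tensor.truncate_eq_zero hj]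
  · have hre := hpos.truncate (δ := δ)
    simp only [N]
    rw [← Complex.ofReal_pow, Real.sq_sqrt (hre.re_nonneg j), hre.ofReal_re]

end WSC.GroupAction

/-! ### Eigenvalues and the Schatten norm -/

section Schatten

variable {m : Type*} [Fintype m] [DecidableEq m]

open Polynomial Unitary in
/-- The spectrum of the square of a Hermitian matrix, with multiplicities. -/
theorem roots_charpoly_mul_self {Y : Matrix m m ℂ} (hY : Y.IsHermitian) :
    (Y * Y).charpoly.roots = univ.val.map fun k => ((hY.eigenvalues k ^ 2 : ℝ) : ℂ) := by
  have h : (Y * Y).charpoly = ∏ k, (X - C ((hY.eigenvalues k ^ 2 : ℝ) : ℂ)) := by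
    conv_lhs => rw [hY.spectral_theorem, ← map_mul, Matrix.diagonal_mul_diagonal,
      conjStarAlgAut_apply, Matrix.charpoly_mul_comm, ← mul_assoc]
    simp [Matrix.charpoly_diagonal, sq]
  rw [h, roots_prod _ _ (Finset.prod_ne_zero_iff.2 fun k _ => X_sub_C_ne_zero _)]
  simp only [roots_X_sub_C, Multiset.bind_singleton]

/-- The singular values of a positive semidefinite matrix are its eigenvalues. -/
theorem schattenNorm_of_posSemidef {ρ : Matrix m m ℂ} (hρ : ρ.PosSemidef) (p : ℝ) :
    schattenNorm p ρ = (∑ k, hρ.isHermitian.eigenvalues k ^ p) ^ (1 / p) := by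
  have h1 := (Matrix.isHermitian_conjTranspose_mul_self ρ).roots_charpoly_eq_eigenvalues
  have h2 := roots_charpoly_mul_self hρ.isHermitian
  have h3 : ρ.conjTranspose * ρ = ρ * ρ := by rw [hρ.isHermitian.eq]
  rw [← h3] at h2
  have h4 := congrArg (fun s => (s.map fun x : ℂ => Real.sqrt x.re ^ p).sum) (h1.symm.trans h2)
  simp only [Multiset.map_map, Function.comp_def, Complex.coe_algebraMap, Complex.ofReal_re,
    Real.sqrt_sq (hρ.eigenvalues_nonneg _)] at h4
  exact congrArg (fun x => x ^ (1 / p)) h4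

theorem sum_norm_sq_row_of_mem_unitaryGroup {W : Matrix m m ℂ} (hW : W ∈ Matrix.unitaryGroup m ℂ)
    (k : m) : ∑ l, ‖W k l‖ ^ 2 = 1 := by
  have h := congrFun (congrFun (Matrix.mem_unitaryGroup_iff.1 hW) k) k
  rw [Matrix.mul_apply, Matrix.one_apply_eq] at h
  have h' : ((∑ l, ‖W k l‖ ^ 2 : ℝ) : ℂ) = 1 := by
    rw [← h]
    push_cast
    refine Finset.sum_congr rfl fun l _ => ?_
    rw [Matrix.star_apply, ← Complex.mul_conj']
    rfl
  exact_mod_cast h'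

theorem sum_norm_sq_col_of_mem_unitaryGroup {W : Matrix m m ℂ} (hW : W ∈ Matrix.unitaryGroup m ℂ)
    (l : m) : ∑ k, ‖W k l‖ ^ 2 = 1 := by
  have h := sum_norm_sq_row_of_mem_unitaryGroup (Unitary.star_mem hW) l
  simpa [Matrix.star_apply] using h

/-- The diagonal entries of a positive semidefinite matrix in any orthonormal basis are averages of
its eigenvalues with doubly stochastic weights, so that Jensen's inequality applies. -/
theorem sum_norm_diag_rpow_le {ρ : Matrix m m ℂ} (hρ : ρ.PosSemidef) {p : ℝ} (hp : 1 ≤ p)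
    {U : Matrix m m ℂ} (hU : U ∈ Matrix.unitaryGroup m ℂ) :
    ∑ k, ‖(star U * ρ * U) k k‖ ^ p ≤ ∑ k, hρ.isHermitian.eigenvalues k ^ p := by
  set r := hρ.isHermitian.eigenvalues with hr
  have hr0 : ∀ l, 0 ≤ r l := hρ.eigenvalues_nonneg
  let V : Matrix m m ℂ := hρ.isHermitian.eigenvectorUnitary
  let W : Matrix m m ℂ := star U * V
  have hW : W ∈ Matrix.unitaryGroup m ℂ :=
    mul_mem (Unitary.star_mem hU) hρ.isHermitian.eigenvectorUnitary.2
  have hspec : star U * ρ * U = W * Matrix.diagonal (fun l => (r l : ℂ)) * star W := by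
    conv_lhs => rw [hρ.isHermitian.spectral_theorem, Unitary.conjStarAlgAut_apply]
    simp only [W, V, star_mul, star_star, mul_assoc]
    rfl
  have hdiag : ∀ k, (star U * ρ * U) k k = ((∑ l, ‖W k l‖ ^ 2 * r l : ℝ) : ℂ) := by
    intro k
    rw [hspec, Matrix.mul_apply]
    push_cast
    refine Finset.sum_congr rfl fun l _ => ?_
    rw [Matrix.mul_diagonal, Matrix.star_apply, ← Complex.mul_conj']
    simp only [RCLike.star_def]
    ring
  calc ∑ k, ‖(star U * ρ * U) k k‖ ^ p
      ≤ ∑ k, ∑ l, ‖W k l‖ ^ 2 * r l ^ p := by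
        refine Finset.sum_le_sum fun k _ => ?_
        rw [hdiag, Complex.norm_of_nonneg
          (Finset.sum_nonneg fun l _ => mul_nonneg (by positivity) (hr0 l))]
        exact Real.rpow_arith_mean_le_arith_mean_rpow _ _ _ (fun _ _ => by positivity)
          (sum_norm_sq_row_of_mem_unitaryGroup hW k) (fun l _ => hr0 l) hp
    _ = ∑ l, r l ^ p := by
        rw [Finset.sum_comm]
        refine Finset.sum_congr rfl fun l _ => ?_
        rw [← Finset.sum_mul, sum_norm_sq_col_of_mem_unitaryGroup hW, one_mul]

theorem convex_sum_norm_diag_rpow_le_one {p : ℝ} (hp : 1 ≤ p) (U : Matrix m m ℂ) :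
    Convex ℝ {Z : Matrix m m ℂ | ∑ k, ‖(star U * Z * U) k k‖ ^ p ≤ 1} := by
  intro Z hZ Z' hZ' a b ha hb hab
  simp only [Set.mem_ofPred_eq] at hZ hZ' ⊢
  calc ∑ k, ‖(star U * (a • Z + b • Z') * U) k k‖ ^ p
      ≤ ∑ k, (a * ‖(star U * Z * U) k k‖ ^ p + b * ‖(star U * Z' * U) k k‖ ^ p) := by
        refine Finset.sum_le_sum fun k _ => ?_
        have hlin : (star U * (a • Z + b • Z') * U) k k =
            a • (star U * Z * U) k k + b • (star U * Z' * U) k k := by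
          simp [mul_add, add_mul]
        rw [hlin]
        have hle : ‖a • (star U * Z * U) k k + b • (star U * Z' * U) k k‖ ≤
            a * ‖(star U * Z * U) k k‖ + b * ‖(star U * Z' * U) k k‖ := by
          refine (norm_add_le _ _).trans_eq ?_
          rw [norm_smul, norm_smul, Real.norm_of_nonneg ha, Real.norm_of_nonneg hb]
        refine (Real.rpow_le_rpow (norm_nonneg _) hle (by linarith)).trans ?_
        exact (convexOn_rpow hp).2 (norm_nonneg _) (norm_nonneg _) ha hb hab
    _ = a * ∑ k, ‖(star U * Z * U) k k‖ ^ p + b * ∑ k, ‖(star U * Z' * U) k k‖ ^ p := by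
        rw [Finset.sum_add_distrib, Finset.mul_sum, Finset.mul_sum]
    _ ≤ a * 1 + b * 1 := by gcongr
    _ = 1 := by linarith

end Schatten

open scoped MatrixOrder in
theorem posSemidef_tensorProd {n d : ℕ} {ρ : Fin (n + 1) → Matrix (Fin d) (Fin d) ℂ}
    (hρ : ∀ i, (ρ i).PosSemidef) : (tensorProd ρ).PosSemidef := by
  choose B hB using fun i => (CStarAlgebra.nonneg_iff_eq_star_mul_self).1 (hρ i).nonneg
  have h : tensorProd ρ = (tensorProd B).conjTranspose * tensorProd B := ?_
  · rw [h]
    exact Matrix.posSemidef_conjTranspose_mul_self _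
  ext a b
  simp only [tensorProd, hB, Matrix.mul_apply, Matrix.star_apply, Matrix.conjTranspose_apply,
    Matrix.of_apply, star_prod, ← Finset.prod_mul_distrib]
  rw [Finset.prod_univ_sum, Fintype.piFinset_univ]

/-- The gauge `μ_p` dominates the Schatten `p`-norm of a Hermitian matrix. -/
theorem sum_abs_eigenvalues_rpow_le {n d : ℕ} {p l : ℝ} (hp : 1 ≤ p) (hl : 0 < l)
    {Y : TensorMatrix n d} (hY : Y.IsHermitian)
    (h : l⁻¹ • Y ∈ convexHull ℝ (productSet n d p)) :
    ∑ k, |hY.eigenvalues k| ^ p ≤ l ^ p := by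
  have hp0 : 0 < p := by linarith
  let U : TensorMatrix n d := hY.eigenvectorUnitary
  have hU : U ∈ Matrix.unitaryGroup _ ℂ := hY.eigenvectorUnitary.2
  have hsub : productSet n d p ⊆ {Z | ∑ k, ‖(star U * Z * U) k k‖ ^ p ≤ 1} := by
    rintro X ⟨ρ, hρ, hnorm, hX⟩
    have hpsd := posSemidef_tensorProd hρ
    have hmem : ∑ k, ‖(star U * tensorProd ρ * U) k k‖ ^ p ≤ 1 := by
      refine (sum_norm_diag_rpow_le hpsd hp hU).trans ?_
      rw [schattenNorm_of_posSemidef hpsd] at hnorm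
      have h0 : 0 ≤ ∑ k, hpsd.isHermitian.eigenvalues k ^ p :=
        Finset.sum_nonneg fun k _ => Real.rpow_nonneg (hpsd.eigenvalues_nonneg k) _
      by_contra! hlt
      exact hnorm.not_gt (Real.one_lt_rpow hlt (by positivity))
    rcases hX with rfl | rfl
    · exact hmem
    · simpa using hmem
  have hmem := convexHull_min hsub (convex_sum_norm_diag_rpow_le_one hp U) h
  have hdiag : ∀ k, ‖(star U * (l⁻¹ • Y) * U) k k‖ = l⁻¹ * |hY.eigenvalues k| := by
    intro k
    have hspec := congrFun (congrFun hY.conjStarAlgAut_star_eigenvectorUnitary k) k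
    rw [Unitary.conjStarAlgAut_star_apply, Matrix.diagonal_apply_eq] at hspec
    rw [mul_smul_comm, smul_mul_assoc, Matrix.smul_apply, norm_smul]
    change _ * ‖(star U * Y * U) k k‖ = _
    rw [show (star U * Y * U) k k = _ from hspec]
    simp [abs_of_pos hl]
  simp only [Set.mem_ofPred_eq, hdiag] at hmem
  simp only [Real.mul_rpow (inv_nonneg.2 hl.le) (abs_nonneg _), ← Finset.mul_sum,
    Real.inv_rpow hl.le] at hmem
  rwa [inv_mul_le_iff₀ (by positivity), mul_one] at hmem

theorem sum_rpow_le_of_muSqrt_le {n d : ℕ} {M : Tensor n d} {p : ℝ} (hp : 1 ≤ p)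
    {K : ℕ} (h : muSqrt p (Matrix.diagonal M) ≤ K) :
    ∑ j, (M j).re ^ (p / 2) ≤ ((K : ℝ) + 1) ^ p := by
  -- the infimum defining `muSqrt` need not be attained, hence the bound `K + 1` instead of `K`
  have hlt : muSqrt p (Matrix.diagonal M) < ENNReal.ofReal (K + 1) := by
    refine h.trans_lt ?_
    rw [← ENNReal.ofReal_natCast]
    exact (ENNReal.ofReal_lt_ofReal_iff (by positivity)).2 (by linarith)
  simp only [muSqrt, mu, iInf_lt_iff] at hlt
  obtain ⟨Y, ⟨hY, hYM⟩, l, ⟨hl, hconv⟩, hlK⟩ := hlt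
  have hlK' : l < K + 1 := (ENNReal.ofReal_lt_ofReal_iff (by positivity)).1 hlK
  have hroots := roots_charpoly_mul_self hY
  rw [hYM, Matrix.charpoly_diagonal, Polynomial.roots_prod _ _
    (by simp [Finset.prod_ne_zero_iff, Polynomial.X_sub_C_ne_zero])] at hroots
  simp only [Polynomial.roots_X_sub_C, Multiset.bind_singleton] at hroots
  have hsum := congrArg (fun s => (s.map fun x : ℂ => x.re ^ (p / 2)).sum) hroots
  simp only [Multiset.map_map, Function.comp_def, Complex.ofReal_re] at hsum
  calc ∑ j, (M j).re ^ (p / 2) = ∑ k, (hY.eigenvalues k ^ 2) ^ (p / 2) := hsum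
    _ = ∑ k, |hY.eigenvalues k| ^ p := by
        refine Finset.sum_congr rfl fun k _ => ?_
        rw [← sq_abs, ← Real.rpow_natCast, ← Real.rpow_mul (abs_nonneg _)]
        congr 1
        push_cast
        ring
    _ ≤ l ^ p := sum_abs_eigenvalues_rpow_le hp hl hY hconv
    _ ≤ _ := by gcongr

/-! ### Uniform bounds on the approximate ranks -/

theorem not_separated_of_le {α : Type*} {X : Set α} {f g : α → ℕ∞} {C : ℕ}
    (h : ∀ x ∈ X, g x ≤ C) : ¬ Separated X f g :=
  fun ⟨_, hx, _, hg⟩ => hg ⟨C, fun k => h _ (hx k)⟩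

theorem Tensor.IsNonneg.sum_rpow_one_le {n d : ℕ} {M : Tensor n d} (hM : M.IsNonneg) {C : ℝ}
    (h : lpNorm 1 M ≤ C) : ∑ j, (M j).re ^ (1 : ℝ) ≤ C := by
  simpa [lpNorm, hM.norm_eq] using h

namespace WSC.GroupAction

variable {n : ℕ} {Ω : WSC n} {G : Type*} [Group G] (A : Ω.GroupAction G)

theorem exists_approxNnRank_le (hΩ : Ω.Connected) (hA : A.IsFree) {ε p : ℝ} (hε : 0 < ε)
    (hp : 1 < p) (K : ℕ) :
    ∃ C : ℕ, ∀ M ∈ boundedTensors A K, A.approxNnRank ε p M.2 ≤ C := by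
  obtain ⟨δ, hδ, h⟩ := exists_truncation_level (sub_pos.2 hp) (Nat.cast_nonneg K)
    (Real.rpow_pos_of_pos hε p)
  refine ⟨⌊(K : ℝ) / δ ^ (1 : ℝ)⌋₊ * Nat.card G, fun M ⟨hpos, hinv, hM⟩ => ?_⟩
  have hsum := hpos.sum_rpow_one_le hM
  refine (A.approxNnRank_le hΩ hA hinv hpos
    (hpos.lpNorm_sub_truncate_le one_pos hp.le hε.le hδ hsum h)).trans ?_
  exact_mod_cast Nat.mul_le_mul_right _
    (Nat.le_floor (hpos.card_largeSupport_le one_pos hδ hsum))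

theorem exists_approxSqrtRank_le (hΩ : Ω.Connected) (hA : A.IsFree) {ε p : ℝ} (hε : 0 < ε)
    (hp : 1 < p) (K : ℕ) :
    ∃ C : ℕ, ∀ M ∈ sqrtBoundedTensors A p K, A.approxSqrtRank ε p M.2 ≤ C := by
  have hp2 : 0 < p / 2 := by linarith
  obtain ⟨δ, hδ, h⟩ := exists_truncation_level (t := p - p / 2) (C := ((K : ℝ) + 1) ^ p)
    (by linarith) (by positivity) (Real.rpow_pos_of_pos hε p)
  refine ⟨⌊((K : ℝ) + 1) ^ p / δ ^ (p / 2)⌋₊ * Nat.card G, fun M ⟨hpos, hinv, hM⟩ => ?_⟩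
  have hsum := sum_rpow_le_of_muSqrt_le hp.le hM
  refine (A.approxSqrtRank_le hΩ hA hinv hpos
    (hpos.lpNorm_sub_truncate_le hp2 (by linarith) hε.le hδ hsum h)).trans ?_
  exact_mod_cast Nat.mul_le_mul_right _ (Nat.le_floor (hpos.card_largeSupport_le hp2 hδ hsum))

/-- For the `ℓ_2`-norm, truncation at `ε² / K` leaves at most `(K / ε)²` coordinates. -/
theorem approxNnRank_two_le (hΩ : Ω.Connected) (hA : A.IsFree) {ε : ℝ} (hε : 0 < ε) {K : ℕ}
    {M : Σ d : ℕ, Tensor n d} (hM : M ∈ boundedTensors A K) :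
    A.approxNnRank ε 2 M.2 ≤
      ((⌈constD 2 * (2 * (K : ℝ) / ε) ^ 2⌉₊ * Nat.card G : ℕ) : ℕ∞) := by
  obtain ⟨hpos, hinv, hM⟩ := hM
  have hsum := hpos.sum_rpow_one_le hM
  obtain ⟨δ, hδ, h, hcard⟩ : ∃ δ : ℝ, 0 < δ ∧ δ ^ ((2 : ℝ) - 1) * K ≤ ε ^ (2 : ℝ) ∧
      K / δ ^ (1 : ℝ) ≤ (K / ε) ^ 2 := by
    have h21 : (2 : ℝ) - 1 = 1 := by norm_num
    simp only [h21, Real.rpow_one, Real.rpow_two]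
    rcases K.eq_zero_or_pos with rfl | hK
    -- for `K = 0` any positive level works
    · exact ⟨1, one_pos, by simp; positivity, by simp⟩
    · have hK' : (0 : ℝ) < K := Nat.cast_pos.2 hK
      refine ⟨ε ^ 2 / K, by positivity, ?_, ?_⟩
      · rw [div_mul_cancel₀ _ hK'.ne']
      · rw [div_div_eq_mul_div, div_pow, sq (K : ℝ)]
  refine (A.approxNnRank_le hΩ hA hinv hpos
    (hpos.lpNorm_sub_truncate_le one_pos one_le_two hε.le hδ hsum h)).trans ?_
  have hle : #(M.2.largeSupport δ) ≤ ⌈constD 2 * (2 * (K : ℝ) / ε) ^ 2⌉₊ := by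
    have hD : (1 : ℝ) ≤ constD 2 * 4 := by
      have := Real.add_one_le_exp (4 : ℝ)
      rw [constD]
      linarith
    have hfinal : ((K : ℝ) / ε) ^ 2 ≤ constD 2 * (2 * (K : ℝ) / ε) ^ 2 := by
      calc ((K : ℝ) / ε) ^ 2 = 1 * (K / ε) ^ 2 := (one_mul _).symm
        _ ≤ constD 2 * 4 * (K / ε) ^ 2 := by gcongr
        _ = _ := by ring
    exact_mod_cast ((hpos.card_largeSupport_le one_pos hδ hsum).trans hcard).trans
      (hfinal.trans (Nat.le_ceil _))
  exact_mod_cast Nat.mul_le_mul_right _ hle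

end WSC.GroupAction

end ApproxTensor

theorem mainTheorem6 {n : ℕ} (Ω : ApproxTensor.WSC n) (hΩ : Ω.Connected)
    {G : Type*} [Group G] (A : Ω.GroupAction G) (hA : A.IsFree)
    (ε : ℝ) (hε : 0 < ε) (K : ℕ) (p : ℝ) (hp : 1 < p) :
    (¬ ApproxTensor.Separated (ApproxTensor.boundedTensors A K)
      (fun M => A.approxRank ε p M.2) (fun M => A.approxPsdRank ε p M.2)) ∧
    (¬ ApproxTensor.Separated (ApproxTensor.boundedTensors A K)
      (fun M => A.approxPsdRank ε p M.2) (fun M => A.approxNnRank ε p M.2)) ∧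
    (¬ ApproxTensor.Separated (ApproxTensor.boundedTensors A K)
      (fun M => A.approxRank ε p M.2) (fun M => A.approxNnRank ε p M.2)) ∧
    (∀ M ∈ ApproxTensor.boundedTensors A K,
      A.approxNnRank ε 2 M.2 ≤
        ((⌈ApproxTensor.constD 2 * (2 * (K : ℝ) / ε) ^ 2⌉₊ * Nat.card G : ℕ) : ℕ∞)) ∧
    (¬ ApproxTensor.Separated (ApproxTensor.sqrtBoundedTensors A p K)
      (fun M => A.approxPsdRank ε p M.2) (fun M => A.approxSqrtRank ε p M.2)) ∧
    (¬ ApproxTensor.Separated (ApproxTensor.sqrtBoundedTensors A p K)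
      (fun M => A.approxRank ε p M.2) (fun M => A.approxSqrtRank ε p M.2)) := by
  obtain ⟨C, hC⟩ := A.exists_approxNnRank_le hΩ hA hε hp K
  obtain ⟨C', hC'⟩ := A.exists_approxSqrtRank_le hΩ hA hε hp K
  exact ⟨ApproxTensor.not_separated_of_le fun M hM =>
      (A.approxPsdRank_le_approxNnRank ε p M.2).trans (hC M hM),
    ApproxTensor.not_separated_of_le hC, ApproxTensor.not_separated_of_le hC,
    fun M hM => A.approxNnRank_two_le hΩ hA hε hM,
    ApproxTensor.not_separated_of_le hC', ApproxTensor.not_separated_of_le hC'⟩
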